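/- **Conventions.** Fix $N\ge 1$, let $B_j\subset\mathbb R^N$ be the closed ball of radius $j$ centred at $0$, and let $V$ be $\mathbb R^N$ or $\mathbb R^{N\times N}$. Let $\mathfrak C(V)$ be the set of Borel functions $f:\mathbb R\times\mathbb R^N\to V$ that have on each compact $K\subset\mathbb R^N$ an *$m$-bound*, i.e. some $m\in L^1_{loc}(\mathbb R)$ such that for a.e. $t$, $|f(t,x)|\le m(t)$ for all $x\in K$. Such an $f$ belongs to $\mathfrak{LC}$ if for each compact $K$ there is $l\in L^1_{loc}(\mathbb R)$ such that for a.e. $t$, $|f(t,x)-f(t,y)|\le l(t)|x-y|$ for all $x,y\in K$; it belongs to $\mathfrak{SC}$ if $f(t,\cdot)$ is continuous for a.e. $t$. Write $f_t(s,x)=f(s+t,x)$. A set $S\subset L^1_{loc}(\mathbb R)$ of nonnegative functions is *$L^1_{loc}$-bounded* if $\sup_{m\in S}\int_{-r}^r m<\infty$ for every $r>0$, and *$L^1_{loc}$-equicontinuous* if for all $r,\varepsilon>0$ there is $\delta>0$ with $\sup_{m\in S}\int_s^t m<\varepsilon$ whenever $-r\le s\le t\le r$ and $t-s<\delta$. A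 function $f$ has $L^1_{loc}$-bounded (resp. $L^1_{loc}$-equicontinuous) $m$-bounds if for each $j\in\mathbb N$ one can choose $m$-bounds on $B_j$ of the functions $f_t$, $t\in\mathbb R$, that form an $L^1_{loc}$-bounded (resp. $L^1_{loc}$-equicontinuous) set. **Setting.** Let $f\in\mathfrak{LC}$, with values in $\mathbb R^N$, be continuously differentiable in $x$ for a.e. $t$ and have $L^1_{loc}$-equicontinuous $m$-bounds, and let $J_xf\in\mathfrak{SC}$, with values in $\mathbb R^{N\times N}$, be its Jacobian in $x$. Put $m^j(t)=\sup_{x\in B_j}|f(t,x)|$ and $\theta_j(s)=\sup_{t\in\mathbb R}\int_t^{t+s}m^j(u)\,du$. For $j\in\mathbb N$ and $I=[q_1,q_2]$ with rational $q_1<q_2$, let $\mathcal K_j^I$ be the set of continuous $x:I\to B_j$ with $|x(s)-x(t)|\le\theta_j(|s-t|)$ for $s,t\in I$. Let $\Theta\mathfrak C$ (resp. $\mathfrak{W}\Theta\mathfrak C$) be the set of $h\in\mathfrak C(V)$ such that for all such $I,j$ and all $x_n,x\in\mathcal K^I_j$ with $x_n\to x$ uniformly, $\int_I|h(t,x_n(t))-h(t,x(t))|\,dt\to0$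 (resp. $\int_I h(t,x_n(t))\,dt\to\int_I h(t,x(t))\,dt$). Let $\mathcal T_\Theta$ (resp. $\sigma_\Theta$) be the topology generated by the seminorms $\sup_{x\in\mathcal K_j^I}\int_I|h(t,x(t))|\,dt$ (resp. $\sup_{x\in\mathcal K_j^I}|\int_I h(t,x(t))\,dt|$). Let $\mathbb H$ be the closure of $\{(f_t,(J_xf)_t):t\in\mathbb R\}$ either in $(\mathfrak{LC},\mathcal T_\Theta)\times(\Theta\mathfrak C,\mathcal T_\Theta)$ or, provided that $J_xf$ has $L^1_{loc}$-equicontinuous $m$-bounds, in $(\mathfrak{LC},\sigma_\Theta)\times(\mathfrak W\Theta\mathfrak C,\sigma_\Theta)$. Put $\Omega=\mathbb H\times\mathbb R^N$. For $\omega=(g,G,x_0)\in\Omega$ let $x(\cdot,g,x_0)$ be the (Carathéodory) solution of $\dot x=g(t,x)$, $x(0)=x_0$, assumed to be defined on all of $\mathbb R$; let $\omega_t=(g_t,G_t,x(t,g,x_0))$, and let $A(\omega)=\lim_{h\to0}\frac1h\int_0^hG(s,x(s,g,x_0))\,ds$ if this limit exists and $A(\omega)=0$ otherwise (so that $A(\omega_t)=G(t,x(t,g,x_0))$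 for a.e. $t$). Let $\Phi(t,\omega)$ be the fundamental matrix solution of $\dot y=A(\omega_t)y$ with $\Phi(0,\omega)=I_N$. A linear system $\dot y=B(t)y$ with fundamental matrix solution $\Phi$, $\Phi(0)=I_N$, has *exponential dichotomy* if there are a projection $P$ of $\mathbb R^N$ and constants $K\ge1$, $\alpha>0$ with $\|\Phi(t)P\Phi^{-1}(s)\|\le Ke^{-\alpha(t-s)}$ for $t\ge s$ and $\|\Phi(t)(I_N-P)\Phi^{-1}(s)\|\le Ke^{\alpha(t-s)}$ for $t\le s$. The *dichotomy spectrum* $\Sigma(\omega)$ is the set of $\gamma\in\mathbb R$ such that $\dot y=(A(\omega_t)-\gamma I_N)y$ does not have exponential dichotomy. **Proposition.** Let $\omega=(g,G,x_0)\in\Omega$. Assume that $G$ has $L^1_{loc}$-bounded $m$-bounds and that $x(\cdot,g,x_0)$ is bounded. Then the system $\dot y=A(\omega_t)\,y$ has *bounded growth*, i.e. there are constants $K\ge1$ and $\alpha\ge0$ with $$\|\Phi(t,\omega)\Phi^{-1}(s,\omega)\|\le Ke^{\alpha|t-s|}\qquad\text{for all }t,s\in\mathbb R,$$ and there are $k$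 with $1\le k\le N$ and reals $a_1\le b_1<a_2\le b_2<\dots<a_k\le b_k$ with $$\Sigma(\omega)=[a_1,b_1]\cup\dots\cup[a_k,b_k].$$ -/

import Mathlib

open Set Filter Topology MeasureTheory

namespace Carath

noncomputable section

/-- The Euclidean space `ℝ^N`. -/
abbrev E (N : ℕ) : Type := EuclideanSpace ℝ (Fin N)

/-- Linear endomorphisms of `ℝ^N` (that is, `N × N` matrices) with the operator norm. -/
abbrev L (N : ℕ) : Type := E N →L[ℝ] E N

/-! ### Carathéodory functions -/

section Classes

variable {N : ℕ} {V : Type} [NormedAddCommGroup V] [NormedSpace ℝ V]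

/-- `m` is an `m`-bound of `f` on `K`. -/
def IsMBound (f : ℝ → E N → V) (K : Set (E N)) (m : ℝ → ℝ) : Prop :=
  LocallyIntegrable m ∧ ∀ᵐ t : ℝ, ∀ x ∈ K, ‖f t x‖ ≤ m t

/-- `f` is Borel measurable and has an `m`-bound on every compact set. -/
def IsC [MeasurableSpace V] (f : ℝ → E N → V) : Prop :=
  Measurable (Function.uncurry f) ∧ ∀ K : Set (E N), IsCompact K → ∃ m, IsMBound f K m

/-- Lipschitz Carathéodory functions. -/
def LC (N : ℕ) (V : Type) [NormedAddCommGroup V] [MeasurableSpace V] : Set (ℝ → E N → V) :=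
  {f | IsC f ∧ ∀ K : Set (E N), IsCompact K → ∃ l : ℝ → ℝ, LocallyIntegrable l ∧
    ∀ᵐ t : ℝ, ∀ x ∈ K, ∀ y ∈ K, ‖f t x - f t y‖ ≤ l t * ‖x - y‖}

/-- Strong Carathéodory functions. -/
def SC (N : ℕ) (V : Type) [NormedAddCommGroup V] [MeasurableSpace V] : Set (ℝ → E N → V) :=
  {f | IsC f ∧ ∀ᵐ t : ℝ, Continuous (f t)}

/-- The set `𝒦_j^I`, `I = [q₁, q₂]`: curves that are continuous on `I`, take values in the closed
ball of radius `j` there, and admit `θ j` as a modulus of continuity on `I`. -/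
def curves (N : ℕ) (θ : ℕ → ℝ → ℝ) (q₁ q₂ : ℚ) (j : ℕ) : Set (ℝ → E N) :=
  {x | ContinuousOn x (Icc (q₁ : ℝ) q₂) ∧ MapsTo x (Icc (q₁ : ℝ) q₂) (Metric.closedBall 0 (j : ℝ)) ∧
    ∀ s ∈ Icc (q₁ : ℝ) q₂, ∀ t ∈ Icc (q₁ : ℝ) q₂, ‖x s - x t‖ ≤ θ j |s - t|}

/-- `Θ`-Carathéodory functions. -/
def TC (N : ℕ) (V : Type) [NormedAddCommGroup V] [MeasurableSpace V] (θ : ℕ → ℝ → ℝ) :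
    Set (ℝ → E N → V) :=
  {f | IsC f ∧ ∀ (j : ℕ) (q₁ q₂ : ℚ), q₁ < q₂ →
    ∀ (u : ℕ → ℝ → E N) (x : ℝ → E N), (∀ n, u n ∈ curves N θ q₁ q₂ j) → x ∈ curves N θ q₁ q₂ j →
      TendstoUniformlyOn u x atTop (Icc (q₁ : ℝ) q₂) →
      Tendsto (fun n => ∫ t in (q₁ : ℝ)..q₂, ‖f t (u n t) - f t (x t)‖) atTop (𝓝 0)}

/-- Weak `Θ`-Carathéodory functions. -/
def WTC (N : ℕ) (V : Type) [NormedAddCommGroup V] [NormedSpace ℝ V] [MeasurableSpace V]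
    (θ : ℕ → ℝ → ℝ) : Set (ℝ → E N → V) :=
  {f | IsC f ∧ ∀ (j : ℕ) (q₁ q₂ : ℚ), q₁ < q₂ →
    ∀ (u : ℕ → ℝ → E N) (x : ℝ → E N), (∀ n, u n ∈ curves N θ q₁ q₂ j) → x ∈ curves N θ q₁ q₂ j →
      TendstoUniformlyOn u x atTop (Icc (q₁ : ℝ) q₂) →
      Tendsto (fun n => ∫ t in (q₁ : ℝ)..q₂, f t (u n t)) atTop
        (𝓝 (∫ t in (q₁ : ℝ)..q₂, f t (x t)))}

/-- The seminorms generating the weak topology `σ_Θ`. -/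
def pSigma (θ : ℕ → ℝ → ℝ) (q₁ q₂ : ℚ) (j : ℕ) (f : ℝ → E N → V) : ℝ :=
  ⨆ x : curves N θ q₁ q₂ j, ‖∫ t in (q₁ : ℝ)..q₂, f t (x.1 t)‖

/-- The seminorms generating the strong topology `𝒯_Θ`. -/
def pStrong (θ : ℕ → ℝ → ℝ) (q₁ q₂ : ℚ) (j : ℕ) (f : ℝ → E N → V) : ℝ :=
  ⨆ x : curves N θ q₁ q₂ j, ∫ t in (q₁ : ℝ)..q₂, ‖f t (x.1 t)‖

/-- The topology on a set `X` of functions generated by the balls, centred at points of `X`, of a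
family of seminorms `p q₁ q₂ j` with `q₁ < q₂` rational and `j` natural. -/
@[reducible] def seminormTopology (X : Set (ℝ → E N → V)) (p : ℚ → ℚ → ℕ → (ℝ → E N → V) → ℝ) :
    TopologicalSpace X :=
  TopologicalSpace.generateFrom
    {U | ∃ (q₁ q₂ : ℚ) (j : ℕ) (c : X) (ε : ℝ), q₁ < q₂ ∧ 0 < ε ∧
      U = {h : X | p q₁ q₂ j (fun t x => h.1 t x - c.1 t x) < ε}}

/-- Time translation: `(translate t f) s x = f (s + t) x`. -/
def translate (t : ℝ) (f : ℝ → E N → V) : ℝ → E N → V := fun s x => f (s + t) x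

/-! ### Boundedness and equicontinuity of `m`-bounds -/

/-- `L¹_loc`-boundedness of a set of functions. -/
def L1locBounded (S : Set (ℝ → ℝ)) : Prop :=
  ∀ r : ℝ, 0 < r → ∃ C : ℝ, ∀ m ∈ S, ∫ t in (-r)..r, m t ≤ C

/-- `L¹_loc`-equicontinuity of a set of functions. -/
def L1locEquicontinuous (S : Set (ℝ → ℝ)) : Prop :=
  ∀ r : ℝ, 0 < r → ∀ ε : ℝ, 0 < ε → ∃ δ : ℝ, 0 < δ ∧
    ∀ s t : ℝ, -r ≤ s → s ≤ t → t ≤ r → t - s < δ → ∀ m ∈ S, ∫ u in s..t, m u < ε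

/-- For every ball `B_j` there is a set of `m`-bounds on `B_j` of the functions in `X`, with at
least one `m`-bound for each of them, that has the property `Q`. -/
def SetHasMBounds (Q : Set (ℝ → ℝ) → Prop) (X : Set (ℝ → E N → V)) : Prop :=
  ∀ j : ℕ, ∃ S : Set (ℝ → ℝ),
    (∀ m ∈ S, ∃ f ∈ X, IsMBound f (Metric.closedBall 0 (j : ℝ)) m) ∧
    (∀ f ∈ X, ∃ m ∈ S, IsMBound f (Metric.closedBall 0 (j : ℝ)) m) ∧ Q S

/-- `f` has `L¹_loc`-bounded `m`-bounds: the set of all its time translates has. -/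
def HasBoundedMBounds (f : ℝ → E N → V) : Prop :=
  SetHasMBounds L1locBounded (range fun t : ℝ => translate t f)

/-- `f` has `L¹_loc`-equicontinuous `m`-bounds: the set of all its time translates has. -/
def HasEquicontinuousMBounds (f : ℝ → E N → V) : Prop :=
  SetHasMBounds L1locEquicontinuous (range fun t : ℝ => translate t f)

/-- The optimal `m`-bound of `f` on the closed ball of radius `j`. -/
def optimalMBound (f : ℝ → E N → V) (j : ℕ) (t : ℝ) : ℝ :=
  ⨆ x : Metric.closedBall (0 : E N) (j : ℝ), ‖f t x.1‖

/-- The moduli of continuity `θ_j(s) = sup_t ∫_t^{t+s} m^j` given by the optimal `m`-bounds. -/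
def theta (f : ℝ → E N → V) (j : ℕ) (s : ℝ) : ℝ :=
  ⨆ t : ℝ, ∫ u in t..(t + s), optimalMBound f j u

end Classes

/-! ### Hulls and the base space -/

section Base

variable {N : ℕ}

/-- `F` is (a strong Carathéodory representative of) the Jacobian of `f` with respect to `x`; in
particular `f t` is continuously differentiable for almost every `t`. -/
def IsJacobian (f : ℝ → E N → E N) (F : ℝ → E N → L N) : Prop :=
  F ∈ SC N (L N) ∧ ∀ᵐ t : ℝ, ∀ x, HasFDerivAt (f t) (F t x) x

/-- The set of pairs in `X × Y` lying in the closure, for the product topology, of the set of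
simultaneous time translates of `(f, F)`. -/
def hull (X : Set (ℝ → E N → E N)) (Y : Set (ℝ → E N → L N))
    (τX : TopologicalSpace X) (τY : TopologicalSpace Y)
    (f : ℝ → E N → E N) (F : ℝ → E N → L N) : Set (X × Y) :=
  @closure (X × Y) (@instTopologicalSpaceProd X Y τX τY)
    {p : X × Y | ∃ t : ℝ, p.1.1 = translate t f ∧ p.2.1 = translate t F}

/-- The hull of `(f, F)` in `(LC × TC, 𝒯_Θ × 𝒯_Θ)`, `Θ` being given by the `m`-bounds of `f`. -/
def hullStrong (f : ℝ → E N → E N) (F : ℝ → E N → L N) :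
    Set (LC N (E N) × TC N (L N) (theta f)) :=
  hull _ _ (seminormTopology _ (pStrong (theta f))) (seminormTopology _ (pStrong (theta f))) f F

/-- The hull of `(f, F)` in `(LC × WTC, σ_Θ × σ_Θ)`, `Θ` being given by the `m`-bounds of `f`. -/
def hullSigma (f : ℝ → E N → E N) (F : ℝ → E N → L N) :
    Set (LC N (E N) × WTC N (L N) (theta f)) :=
  hull _ _ (seminormTopology _ (pSigma (theta f))) (seminormTopology _ (pSigma (theta f))) f F

/-- Triples `ω = (g, G, x₀)`. -/
abbrev Triple (N : ℕ) : Type := (ℝ → E N → E N) × (ℝ → E N → L N) × E N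

/-- `Ω = ℍ_𝒯 × ℝ^N`. -/
def OmegaStrong (f : ℝ → E N → E N) (F : ℝ → E N → L N) : Set (Triple N) :=
  {ω | ∃ p ∈ hullStrong f F, ω.1 = p.1.1 ∧ ω.2.1 = p.2.1}

/-- `Ω = ℍ_σ × ℝ^N`. -/
def OmegaSigma (f : ℝ → E N → E N) (F : ℝ → E N → L N) : Set (Triple N) :=
  {ω | ∃ p ∈ hullSigma f F, ω.1 = p.1.1 ∧ ω.2.1 = p.2.1}

/-! ### Solutions, the flow on the base, and the coefficient matrix -/

/-- `x` is a Carathéodory solution, defined on all of `ℝ`, of `ẋ = g(t, x)`, `x(0) = x₀`. -/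
def IsGlobalSolution (g : ℝ → E N → E N) (x₀ : E N) (x : ℝ → E N) : Prop :=
  Continuous x ∧ (∀ a b : ℝ, IntervalIntegrable (fun s => g s (x s)) volume a b) ∧
    ∀ t : ℝ, x t = x₀ + ∫ s in (0 : ℝ)..t, g s (x s)

/-- `x(·, g, x₀)` is globally defined. -/
def GloballyDefined (g : ℝ → E N → E N) (x₀ : E N) : Prop :=
  ∃ x, IsGlobalSolution g x₀ x

open Classical in
/-- The solution `x(·, g, x₀)` (only used when it is globally defined; it is unique for
`g ∈ LC`). -/
def sol (g : ℝ → E N → E N) (x₀ : E N) : ℝ → E N :=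
  if h : GloballyDefined g x₀ then h.choose else fun _ => 0

/-- The flow on the base: `ω_t = (g_t, G_t, x(t, g, x₀))`. -/
def baseFlow (ω : Triple N) (t : ℝ) : Triple N :=
  (translate t ω.1, translate t ω.2.1, sol ω.1 ω.2.2 t)

open Classical in
/-- `A(ω) = lim_{h → 0} (1/h) ∫_0^h G(s, x(s, g, x₀)) ds` if the limit exists, and `0` otherwise. -/
def coeff (ω : Triple N) : L N :=
  if h : ∃ B : L N, Tendsto
      (fun h : ℝ => h⁻¹ • ∫ s in (0 : ℝ)..h, ω.2.1 s (sol ω.1 ω.2.2 s)) (𝓝[≠] 0) (𝓝 B)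
  then h.choose else 0

/-! ### Linear systems: bounded growth, exponential dichotomy, dichotomy spectrum -/

/-- `Φ` is the fundamental matrix solution of `ẏ = A(t) y` with `Φ(0) = I` (in the sense of
Carathéodory). -/
def IsFundamental (A : ℝ → L N) (Φ : ℝ → (L N)ˣ) : Prop :=
  (∀ a b : ℝ, IntervalIntegrable (fun s => A s * (Φ s : L N)) volume a b) ∧
    ∀ t : ℝ, (Φ t : L N) = 1 + ∫ s in (0 : ℝ)..t, A s * (Φ s : L N)

/-- The system `ẏ = A(t) y` has bounded growth. -/
def HasBoundedGrowth (A : ℝ → L N) : Prop :=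
  ∃ Φ : ℝ → (L N)ˣ, IsFundamental A Φ ∧
    ∃ K α : ℝ, 1 ≤ K ∧ 0 ≤ α ∧
      ∀ t s : ℝ, ‖(Φ t : L N) * ((Φ s)⁻¹ : (L N)ˣ)‖ ≤ K * Real.exp (α * |t - s|)

/-- The system `ẏ = A(t) y` has exponential dichotomy (on `ℝ`). -/
def HasExpDichotomy (A : ℝ → L N) : Prop :=
  ∃ Φ : ℝ → (L N)ˣ, IsFundamental A Φ ∧
    ∃ P : L N, P * P = P ∧ ∃ K α : ℝ, 1 ≤ K ∧ 0 < α ∧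
      (∀ t s : ℝ, s ≤ t →
        ‖(Φ t : L N) * P * ((Φ s)⁻¹ : (L N)ˣ)‖ ≤ K * Real.exp (-α * (t - s))) ∧
      (∀ t s : ℝ, t ≤ s →
        ‖(Φ t : L N) * (1 - P) * ((Φ s)⁻¹ : (L N)ˣ)‖ ≤ K * Real.exp (α * (t - s)))

/-- The dichotomy spectrum of `ẏ = A(t) y`. -/
def dichotomySpectrum (A : ℝ → L N) : Set ℝ :=
  {γ | ¬ HasExpDichotomy fun t => A t - γ • (1 : L N)}

end Base

end

end Carath

/-! Since `coeff` is a derivative of the primitive of `G` along the solution, the flow property of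
solutions and Lebesgue differentiation give A(ω_t) = G(t, x(t)) for a.e. t (`coeff_baseFlow_ae_eq`).
A bounded solution stays in one ball B_j, so the L¹_loc-bounded m-bounds of the translates of G
bound ∫_t^{t+1} ‖A‖ by a constant C independent of t (`exists_integral_norm_comp_le`). The Picard
series then gives ‖Φ(t)Φ(s)⁻¹‖ ≤ exp |∫_s^t ‖A‖| ≤ e^C e^{C|t-s|}, which is bounded growth.

For the spectrum, a dichotomy at γ splits ℝ^N into the data of solutions growing more slowly than
e^{γt} forwards (the range of P) and those decaying faster than e^{γt} backwards (its kernel). The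
range grows with γ and the kernel shrinks (`IsDichotomyProjection.mul_eq`), so the rank of P is
monotone on the resolvent set. It is locally constant, and two resolvent points of equal rank share
the same P, so no spectrum lies between them. Bounded growth makes the rank 0 for γ < -α and N for γ
> α. Hence the attained ranks number at least 2 and at most N + 1, and the spectrum consists of the
compact intervals separating consecutive ones (`exists_eq_iUnion_Icc_of_rank`). -/

namespace Carath

/-! ### Absolute continuity, primitives and a Gronwall-type uniqueness principle -/

section AbsoluteContinuity

variable {V : Type*} [NormedAddCommGroup V]

theorem absolutelyContinuousOnInterval_of_dist_le {W : Type*} [NormedAddCommGroup W]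
    {f : ℝ → V} {g : ℝ → W} {a b : ℝ} (hg : AbsolutelyContinuousOnInterval g a b)
    (h : ∀ x y, dist (f x) (f y) ≤ dist (g x) (g y)) : AbsolutelyContinuousOnInterval f a b := by
  rw [absolutelyContinuousOnInterval_iff] at hg ⊢
  intro ε hε
  obtain ⟨δ, hδ, H⟩ := hg ε hε
  exact ⟨δ, hδ, fun E hE hlt => (Finset.sum_le_sum fun i _ => h _ _).trans_lt (H E hE hlt)⟩

theorem locallyIntegrable_of_intervalIntegrable {f : ℝ → V}
    (hf : ∀ a b, IntervalIntegrable f volume a b) : LocallyIntegrable f := by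
  intro x
  refine ⟨Ioc (x - 1) (x + 1), ?_, ?_⟩
  · exact Ioc_mem_nhds (by linarith) (by linarith)
  · exact (intervalIntegrable_iff_integrableOn_Ioc_of_le (by linarith)).1 (hf _ _)

theorem intervalIntegrable_of_locallyIntegrable {f : ℝ → V} (hf : LocallyIntegrable f) (a b : ℝ) :
    IntervalIntegrable f volume a b :=
  intervalIntegrable_iff.mpr
    ((hf.integrableOn_isCompact isCompact_uIcc).mono_set uIoc_subset_uIcc)

/-- A continuous function vanishing at one point and whose increments are controlled by the
integral of its norm against a locally integrable weight vanishes identically. -/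
theorem eq_zero_of_norm_sub_le_integral {u : ℝ → V} (hu : Continuous u)
    (h : ∀ R : ℝ, ∃ l : ℝ → ℝ, (∀ a b, IntervalIntegrable l volume a b) ∧ (∀ t, 0 ≤ l t) ∧
      ∀ s ∈ Icc (-R) R, ∀ t ∈ Icc (-R) R, ‖u t - u s‖ ≤ |∫ r in s..t, l r * ‖u r‖|)
    {t₀ : ℝ} (h0 : u t₀ = 0) (t : ℝ) : u t = 0 := by
  -- The zero set is clopen. Near a zero the weight has integral below 1/2, so at a maximum point m
  -- of ‖u‖ on a small interval ‖u m‖ ≤ ‖u m‖ / 2.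
  have hopen : IsOpen {t | u t = 0} := by
    rw [isOpen_iff_mem_nhds]
    intro s (hs : u s = 0)
    obtain ⟨l, hl, hl0, H⟩ := h (|s| + 1)
    have hc : Continuous fun t => ∫ r in s..t, l r := intervalIntegral.continuous_primitive hl s
    have hev : ∀ᶠ t in 𝓝 s, |∫ r in s..t, l r| < 1 / 2 := by
      have := hc.abs.tendsto s
      simp only [intervalIntegral.integral_same, abs_zero] at this
      exact this.eventually (gt_mem_nhds (by norm_num))
    obtain ⟨δ, hδ, hball⟩ := Metric.eventually_nhds_iff.1 hev
    set η := min (δ / 2) 1 with hη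
    have hη0 : 0 < η := by positivity
    have hη1 : η ≤ 1 := min_le_right _ _
    have hηδ : η < δ := (min_le_left _ _).trans_lt (by linarith)
    have hsub : ∀ t ∈ Icc (s - η) (s + η), t ∈ Icc (-(|s| + 1)) (|s| + 1) := by
      intro t ht
      have := neg_abs_le s
      have := le_abs_self s
      constructor <;> linarith [ht.1, ht.2]
    obtain ⟨m, hm, hmax⟩ := (isCompact_Icc (a := s - η) (b := s + η)).exists_isMaxOn
      ⟨s, by constructor <;> linarith⟩ hu.norm.continuousOn
    have hle : ‖u m‖ ≤ 1 / 2 * ‖u m‖ := by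
      have h1 := H s (hsub s (by constructor <;> linarith)) m (hsub m hm)
      rw [hs, sub_zero] at h1
      have h2 : |∫ r in s..m, l r * ‖u r‖| ≤ |∫ r in s..m, l r * ‖u m‖| := by
        rw [← Real.norm_eq_abs]
        refine intervalIntegral.norm_integral_le_abs_of_norm_le ?_ ((hl _ _).mul_const _)
        refine (ae_restrict_iff' measurableSet_uIoc).2 (ae_of_all _ fun r hr => ?_)
        rw [Real.norm_of_nonneg (mul_nonneg (hl0 _) (norm_nonneg _))]
        refine mul_le_mul_of_nonneg_left (hmax ?_) (hl0 r)
        have hr' := uIoc_subset_uIcc hr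
        exact (uIcc_subset_Icc (by constructor <;> linarith) hm) hr'
      rw [intervalIntegral.integral_mul_const, abs_mul, abs_norm] at h2
      have h3 : |∫ r in s..m, l r| ≤ 1 / 2 := (hball (by
        rw [Real.dist_eq, abs_lt]; constructor <;> linarith [hm.1, hm.2])).le
      exact h1.trans (h2.trans (mul_le_mul_of_nonneg_right h3 (norm_nonneg _)))
    have hm0 : ‖u m‖ = 0 := le_antisymm (by linarith) (norm_nonneg _)
    refine mem_of_superset (Icc_mem_nhds (show s - η < s by linarith) (show s < s + η by linarith))
      fun t ht => ?_
    have := hmax ht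
    simp only [hm0, mem_ofPred_eq] at this
    exact norm_eq_zero.1 (le_antisymm this (norm_nonneg _))
  have hclosed : IsClosed {t | u t = 0} := isClosed_eq hu continuous_const
  have := IsClopen.eq_univ ⟨hclosed, hopen⟩ ⟨t₀, h0⟩
  exact (this.symm ▸ mem_univ t : t ∈ {t | u t = 0})

variable [NormedSpace ℝ V]

/-- The increments are dominated by those of the scalar primitive of ‖f‖. -/
theorem absolutelyContinuousOnInterval_primitive {f : ℝ → V}
    (hf : ∀ a b, IntervalIntegrable f volume a b) (s a b : ℝ) :
    AbsolutelyContinuousOnInterval (fun t => ∫ u in s..t, f u) a b := by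
  have h1 : AbsolutelyContinuousOnInterval (fun t => ∫ u in a..t, ‖f u‖) a b :=
    (hf a b).norm.absolutelyContinuousOnInterval_intervalIntegral (by simp)
  refine absolutelyContinuousOnInterval_of_dist_le h1 fun x y => ?_
  rw [dist_eq_norm, dist_eq_norm, intervalIntegral.integral_interval_sub_left (hf _ _) (hf _ _),
    intervalIntegral.integral_interval_sub_left (hf _ _).norm (hf _ _).norm]
  exact intervalIntegral.norm_integral_le_abs_integral_norm

/-- Subtracting the primitive of u' leaves an absolutely continuous function with a.e. zero
derivative, hence a constant. -/
theorem sub_eq_integral_of_absolutelyContinuous [CompleteSpace V] {u u' : ℝ → V} {a b : ℝ}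
    (hu : AbsolutelyContinuousOnInterval u a b) (hu' : ∀ a b, IntervalIntegrable u' volume a b)
    (hd : ∀ᵐ x, HasDerivAt u (u' x) x) : u b - u a = ∫ t in a..b, u' t := by
  obtain ⟨C, hC⟩ := (hu.sub
    (absolutelyContinuousOnInterval_primitive hu' a a b)).const_of_ae_hasDerivAt_zero (by
      filter_upwards [hd,
        LocallyIntegrable.ae_hasDerivAt_integral (locallyIntegrable_of_intervalIntegrable hu')] with x h1 h2 _
      simpa using h1.sub (h2 a))
  have h1 := hC a (by simp)
  have h2 := hC b (by simp)
  simp only [Pi.sub_apply, intervalIntegral.integral_same, sub_zero] at h1 h2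
  rw [h1, ← h2]
  abel

/-- The power rule for a primitive that is only a.e. differentiable; it produces the factorials in
the Picard estimate. -/
theorem integral_mul_primitive_pow {a : ℝ → ℝ} (ha : ∀ x y, IntervalIntegrable a volume x y)
    (s t : ℝ) (n : ℕ) :
    ∫ r in s..t, a r * (∫ v in s..r, a v) ^ n = (∫ v in s..t, a v) ^ (n + 1) / (n + 1) := by
  have hM : Continuous fun r => ∫ v in s..r, a v := intervalIntegral.continuous_primitive ha s
  have hac := absolutelyContinuousOnInterval_primitive ha s s t
  have hacn : ∀ n : ℕ, AbsolutelyContinuousOnInterval (fun r => (∫ v in s..r, a v) ^ (n + 1)) s t := by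
    intro n
    induction n with
    | zero => simpa using hac
    | succ n ih => simpa only [pow_succ] using ih.fun_mul hac
  have key := sub_eq_integral_of_absolutelyContinuous (hacn n)
    (u' := fun r => (n + 1) * (a r * (∫ v in s..r, a v) ^ n))
    (fun x y => ((ha x y).mul_continuousOn (hM.pow n).continuousOn).const_mul _) (by
      filter_upwards [LocallyIntegrable.ae_hasDerivAt_integral
        (locallyIntegrable_of_intervalIntegrable ha)] with x h
      convert! (h s).pow (n + 1) using 1
      push_cast
      ring)
  rw [intervalIntegral.integral_const_mul] at key
  simp only [intervalIntegral.integral_same] at key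
  have : (n : ℝ) + 1 ≠ 0 := by positivity
  field_simp
  rw [mul_comm, ← key]
  simp

end AbsoluteContinuity


/-! ### Linear Carathéodory systems: uniqueness, Picard series, exponential shifts -/

section LinearSystems

variable {R : Type*} [NormedRing R] [NormedAlgebra ℝ R] {A : ℝ → R}

/-- `Y` is a Carathéodory solution of `Ẏ = A(t) Y`. -/
def IsLinearSolution (A : ℝ → R) (Y : ℝ → R) : Prop :=
  Continuous Y ∧ ∀ s t : ℝ, Y t - Y s = ∫ r in s..t, A r * Y r

theorem IsLinearSolution.mul_const {Y : ℝ → R} (hY : IsLinearSolution A Y) (C : R)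
    [CompleteSpace R] (hA : ∀ a b, IntervalIntegrable A volume a b) :
    IsLinearSolution A fun t => Y t * C := by
  refine ⟨hY.1.mul continuous_const, fun s t => ?_⟩
  rw [← sub_mul, hY.2]
  have := ((ContinuousLinearMap.mul ℝ R).flip C).intervalIntegral_comp_comm
    ((hA s t).mul_continuousOn hY.1.continuousOn)
  simpa [mul_assoc] using this.symm

theorem IsLinearSolution.eq_of_eq_at (hA : ∀ a b, IntervalIntegrable A volume a b) {Y Z : ℝ → R}
    (hY : IsLinearSolution A Y) (hZ : IsLinearSolution A Z) {s : ℝ} (h : Y s = Z s) (t : ℝ) :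
    Y t = Z t := by
  refine sub_eq_zero.1 (eq_zero_of_norm_sub_le_integral (u := fun t => Y t - Z t)
    (hY.1.sub hZ.1) (fun R => ⟨fun t => ‖A t‖, fun a b => (hA a b).norm, fun t => norm_nonneg _,
      fun s _ t _ => ?_⟩) (sub_eq_zero.2 h) t)
  have h1 : Y t - Z t - (Y s - Z s) = ∫ r in s..t, A r * (Y r - Z r) := by
    rw [sub_sub_sub_comm, hY.2, hZ.2, ← intervalIntegral.integral_sub
      ((hA s t).mul_continuousOn hY.1.continuousOn) ((hA s t).mul_continuousOn hZ.1.continuousOn)]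
    simp only [mul_sub]
  rw [h1, ← Real.norm_eq_abs]
  exact intervalIntegral.norm_integral_le_abs_of_norm_le
    (ae_of_all _ fun r => norm_mul_le _ _)
    ((hA s t).norm.mul_continuousOn (hY.1.sub hZ.1).norm.continuousOn)

/-- The terms of the Picard series of `Ẏ = A(t) Y`, `Y(s) = 1`. -/
noncomputable def picardTerm (A : ℝ → R) (s : ℝ) : ℕ → ℝ → R
  | 0 => fun _ => 1
  | n + 1 => fun t => ∫ r in s..t, A r * picardTerm A s n r

theorem continuous_picardTerm (hA : ∀ a b, IntervalIntegrable A volume a b) (s : ℝ) (n : ℕ) :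
    Continuous (picardTerm A s n) := by
  induction n with
  | zero => exact continuous_const
  | succ n ih =>
    exact intervalIntegral.continuous_primitive
      (fun a b => (hA a b).mul_continuousOn ih.continuousOn) s

theorem abs_integral_mul_abs_primitive_pow {a : ℝ → ℝ}
    (ha : ∀ x y, IntervalIntegrable a volume x y) (ha0 : ∀ t, 0 ≤ a t) (s t : ℝ) (n : ℕ) :
    |∫ r in s..t, a r * |∫ v in s..r, a v| ^ n| = |∫ v in s..t, a v| ^ (n + 1) / (n + 1) := by
  have key := congrArg abs (integral_mul_primitive_pow ha s t n)
  rw [abs_div, abs_pow, abs_of_nonneg (show (0 : ℝ) ≤ n + 1 by positivity)] at key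
  rw [← key]
  rcases le_total s t with hst | hst
  · congr 1
    refine intervalIntegral.integral_congr fun r hr => ?_
    rw [uIcc_of_le hst] at hr
    rw [abs_of_nonneg (intervalIntegral.integral_nonneg hr.1 fun u _ => ha0 u)]
  -- Backwards in time the primitive is nonpositive, so the two integrals differ only by the sign
  -- (-1)^n.
  · have : ∫ r in s..t, a r * |∫ v in s..r, a v| ^ n
        = (-1) ^ n * ∫ r in s..t, a r * (∫ v in s..r, a v) ^ n := by
      rw [← intervalIntegral.integral_const_mul]
      refine intervalIntegral.integral_congr fun r hr => ?_
      rw [uIcc_of_ge hst] at hr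
      rw [abs_of_nonpos, neg_pow]
      · ring
      · rw [intervalIntegral.integral_symm]
        exact neg_nonpos.2 (intervalIntegral.integral_nonneg hr.2 fun u _ => ha0 u)
    rw [this, abs_mul]
    simp

theorem norm_picardTerm_le (hA : ∀ a b, IntervalIntegrable A volume a b) (s : ℝ) (n : ℕ) (t : ℝ) :
    ‖picardTerm A s n t‖ ≤ ‖(1 : R)‖ * (|∫ r in s..t, ‖A r‖| ^ n / n.factorial) := by
  induction n generalizing t with
  | zero => simp [picardTerm]
  | succ n ih =>
    have hM : Continuous fun t => ∫ r in s..t, ‖A r‖ :=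
      intervalIntegral.continuous_primitive (fun a b => (hA a b).norm) s
    have h1 : ‖picardTerm A s (n + 1) t‖ ≤
        |∫ r in s..t, ‖A r‖ * |∫ v in s..r, ‖A v‖| ^ n * (‖(1 : R)‖ / n.factorial)| := by
      refine intervalIntegral.norm_integral_le_abs_of_norm_le (ae_of_all _ fun r => ?_) ?_
      · refine (norm_mul_le _ _).trans ?_
        refine (mul_le_mul_of_nonneg_left (ih r) (norm_nonneg _)).trans (le_of_eq ?_)
        ring
      · exact ((hA s t).norm.mul_continuousOn (hM.abs.pow n).continuousOn).mul_const _
    rw [intervalIntegral.integral_mul_const, abs_mul,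
      abs_integral_mul_abs_primitive_pow (fun a b => (hA a b).norm) (fun t => norm_nonneg _),
      abs_of_nonneg (show 0 ≤ ‖(1 : R)‖ / n.factorial by positivity)] at h1
    refine h1.trans (le_of_eq ?_)
    rw [Nat.factorial_succ]
    push_cast
    field_simp

/-- The fundamental solution of the system shifted by `-γ`. -/
noncomputable def shiftedSolution (Φ : ℝ → Rˣ) (γ t : ℝ) : Rˣ where
  val := Real.exp (-γ * t) • (Φ t : R)
  inv := Real.exp (γ * t) • ((Φ t)⁻¹ : Rˣ)
  val_inv := by
    rw [smul_mul_smul_comm, ← Real.exp_add, Units.mul_inv]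
    simp
  inv_val := by
    rw [smul_mul_smul_comm, ← Real.exp_add, Units.inv_mul]
    simp

theorem norm_shiftedSolution_mul_mul_inv (Φ : ℝ → Rˣ) (γ t s : ℝ) (P : R) :
    ‖(shiftedSolution Φ γ t : R) * P * ((shiftedSolution Φ γ s)⁻¹ : Rˣ)‖ =
      Real.exp (-γ * (t - s)) * ‖(Φ t : R) * P * ((Φ s)⁻¹ : Rˣ)‖ := by
  change ‖(Real.exp (-γ * t) • (Φ t : R)) * P * (Real.exp (γ * s) • ((Φ s)⁻¹ : Rˣ))‖ = _
  rw [smul_mul_assoc, smul_mul_smul_comm, ← Real.exp_add, norm_smul, Real.norm_eq_abs,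
    Real.abs_exp]
  ring_nf

variable [CompleteSpace R]

/-- The Picard series is dominated by the exponential series, uniformly on compact intervals. This
gives continuity of the sum, termwise integration and the norm bound. -/
theorem exists_isLinearSolution (hA : ∀ a b, IntervalIntegrable A volume a b) (s : ℝ) :
    ∃ Y : ℝ → R, IsLinearSolution A Y ∧ Y s = 1 ∧
      ∀ t, ‖Y t‖ ≤ ‖(1 : R)‖ * Real.exp |∫ r in s..t, ‖A r‖| := by
  have hM : Continuous fun t => |∫ r in s..t, ‖A r‖| :=
    (intervalIntegral.continuous_primitive (fun a b => (hA a b).norm) s).abs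
  have hexp : ∀ c : ℝ, HasSum (fun n : ℕ => ‖(1 : R)‖ * (c ^ n / n.factorial))
      (‖(1 : R)‖ * Real.exp c) := by
    intro c
    rw [Real.exp_eq_exp_ℝ]
    exact (NormedSpace.expSeries_div_hasSum_exp c).mul_left _
  have hsum : ∀ t, Summable fun n => picardTerm A s n t := fun t =>
    Summable.of_norm_bounded (hexp _).summable fun n => norm_picardTerm_le hA s n t
  have hbd : ∀ a b : ℝ, ∃ c : ℝ, ∀ t ∈ uIcc a b, ∀ n,
      ‖picardTerm A s n t‖ ≤ ‖(1 : R)‖ * (c ^ n / n.factorial) := by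
    intro a b
    obtain ⟨c, hc⟩ := (isCompact_uIcc (a := a) (b := b)).bddAbove_image hM.continuousOn
    refine ⟨c, fun t ht n => (norm_picardTerm_le hA s n t).trans ?_⟩
    have : |∫ r in s..t, ‖A r‖| ≤ c := hc (mem_image_of_mem _ ht)
    gcongr
  set Y : ℝ → R := fun t => ∑' n, picardTerm A s n t with hYdef
  have hYc : Continuous Y := by
    rw [continuous_iff_continuousAt]
    intro t
    obtain ⟨c, hc⟩ := hbd (t - 1) (t + 1)
    refine (continuousOn_tsum (fun n => (continuous_picardTerm hA s n).continuousOn)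
      (hexp c).summable (fun n x hx => hc x hx n)).continuousAt ?_
    rw [uIcc_of_le (by linarith)]
    exact Icc_mem_nhds (by linarith) (by linarith)
  have hYi : ∀ a b, IntervalIntegrable (fun r => A r * Y r) volume a b := fun a b =>
    (hA a b).mul_continuousOn hYc.continuousOn
  have hYeq : ∀ t, Y t = 1 + ∫ r in s..t, A r * Y r := by
    intro t
    obtain ⟨c, hc⟩ := hbd s t
    have h1 : HasSum (fun n => ∫ r in s..t, A r * picardTerm A s n r)
        (∫ r in s..t, A r * Y r) := by
      refine intervalIntegral.hasSum_integral_of_dominated_convergence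
        (fun n r => ‖A r‖ * (‖(1 : R)‖ * (c ^ n / n.factorial))) (fun n => ?_) (fun n => ?_) ?_ ?_ ?_
      · exact (IntervalIntegrable.mul_continuousOn (hA s t)
          (continuous_picardTerm hA s n).continuousOn).def'.aestronglyMeasurable
      · refine ae_of_all _ fun r hr => (norm_mul_le _ _).trans ?_
        exact mul_le_mul_of_nonneg_left (hc r (uIoc_subset_uIcc hr) n) (norm_nonneg _)
      · exact ae_of_all _ fun r _ => (hexp c).summable.mul_left _
      · simp only [tsum_mul_left]
        exact (hA s t).norm.mul_const _
      · exact ae_of_all _ fun r _ => (hsum r).hasSum.mul_left _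
    have h2 := (hsum t).tsum_eq_zero_add
    rw [hYdef]
    simp only
    rw [h2, ← h1.tsum_eq]
    rfl
  refine ⟨Y, ⟨hYc, fun a b => ?_⟩, by simpa using hYeq s, fun t => ?_⟩
  · rw [hYeq a, hYeq b, add_sub_add_left_eq_sub,
      intervalIntegral.integral_interval_sub_left (hYi _ _) (hYi _ _)]
  · exact tsum_of_norm_bounded (hexp _) fun n => norm_picardTerm_le hA s n t

/-- A linear system with locally integrable coefficient has an invertible fundamental solution,
and the norm of the evolution operator is bounded by the exponential of the integral of the
norm of the coefficient. -/
theorem exists_units_isLinearSolution (hA : ∀ a b, IntervalIntegrable A volume a b) :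
    ∃ Φ : ℝ → Rˣ, IsLinearSolution A (fun t => (Φ t : R)) ∧ Φ 0 = 1 ∧
      ∀ t s, ‖(Φ t : R) * ((Φ s)⁻¹ : Rˣ)‖ ≤ ‖(1 : R)‖ * Real.exp |∫ r in s..t, ‖A r‖| := by
  choose Y hY hY1 hYb using exists_isLinearSolution hA
  -- By uniqueness the solutions started at different times form a cocycle, so `Y t 0` inverts `Y 0
  -- t`.
  have hflow : ∀ s t, Y s t * Y 0 s = Y 0 t := fun s t =>
    ((hY s).mul_const (Y 0 s) hA).eq_of_eq_at hA (hY 0) (s := s) (by simp [hY1]) t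
  have hflow' : ∀ s t, Y 0 t * Y s 0 = Y s t := fun s t =>
    ((hY 0).mul_const (Y s 0) hA).eq_of_eq_at hA (hY s) (s := 0) (by simp [hY1]) t
  refine ⟨fun t => ⟨Y 0 t, Y t 0, by rw [hflow', hY1], by rw [hflow, hY1]⟩, hY 0,
    Units.ext (hY1 0), fun t s => ?_⟩
  change ‖Y 0 t * Y s 0‖ ≤ _
  rw [hflow']
  exact hYb s t

/-- The product rule holds a.e., and absolute continuity of the product turns it back into an
integral equation. -/
theorem IsLinearSolution.exp_smul (hA : ∀ a b, IntervalIntegrable A volume a b) {Y : ℝ → R}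
    (hY : IsLinearSolution A Y) (c : ℝ) :
    IsLinearSolution (fun t => A t + c • (1 : R)) fun t => Real.exp (c * t) • Y t := by
  have he : Continuous fun t : ℝ => Real.exp (c * t) := by fun_prop
  have hAY : ∀ a b, IntervalIntegrable (fun r => A r * Y r) volume a b := fun a b =>
    (hA a b).mul_continuousOn hY.1.continuousOn
  have hAc : ∀ a b, IntervalIntegrable (fun t => A t + c • (1 : R)) volume a b := fun a b =>
    (hA a b).add intervalIntegrable_const
  refine ⟨he.smul hY.1, fun s t => ?_⟩
  have hYs : ∀ t, Y t = Y s + ∫ r in s..t, A r * Y r := by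
    intro t
    rw [← hY.2 s t]
    abel
  have hYac : AbsolutelyContinuousOnInterval Y s t := by
    refine absolutelyContinuousOnInterval_of_dist_le
      (absolutelyContinuousOnInterval_primitive hAY s s t) fun x y => ?_
    rw [hYs x, hYs y, dist_add_left]
  have heac : AbsolutelyContinuousOnInterval (fun t : ℝ => Real.exp (c * t)) s t :=
    ContDiffOn.absolutelyContinuousOnInterval (by fun_prop)
  refine sub_eq_integral_of_absolutelyContinuous (heac.smul hYac)
    (fun a b => (hAc a b).mul_continuousOn (he.smul hY.1).continuousOn) ?_
  filter_upwards [LocallyIntegrable.ae_hasDerivAt_integral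
    (locallyIntegrable_of_intervalIntegrable hAY)] with x hx
  have h1 : HasDerivAt Y (A x * Y x) x :=
    ((hx s).const_add (Y s)).congr_of_eventuallyEq (Eventually.of_forall hYs)
  have h2 : HasDerivAt (fun t : ℝ => Real.exp (c * t)) (c * Real.exp (c * x)) x := by
    have := ((hasDerivAt_id x).const_mul c).exp
    simpa [mul_comm] using this
  convert! h2.smul h1 using 1
  rw [add_mul, smul_one_mul, mul_smul_comm, smul_smul]

end LinearSystems


/-! ### Order structure of a set from a rank function on its complement -/

/-- A set of reals whose complement carries a monotone, locally constant function with values in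
`{0, …, N}` and order-convex level sets, equal to `0` near `-∞` and to `N` near `+∞`, is a disjoint
union of at least one and at most `N` compact intervals. -/
theorem exists_eq_iUnion_Icc_of_rank {S : Set ℝ} {r : ℝ → ℕ} {N : ℕ} (hN : 1 ≤ N)
    (hopen : ∀ x ∉ S, ∀ᶠ y in 𝓝 x, y ∉ S ∧ r y = r x)
    (hmono : ∀ x ∉ S, ∀ y ∉ S, x ≤ y → r x ≤ r y)
    (hconv : ∀ x ∉ S, ∀ y ∉ S, r x = r y → ∀ z ∈ Icc x y, z ∉ S)
    (hlow : ∃ c, ∀ x < c, x ∉ S ∧ r x = 0) (hhigh : ∃ c, ∀ x > c, x ∉ S ∧ r x = N) :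
    ∃ (k : ℕ) (a b : Fin k → ℝ), 1 ≤ k ∧ k ≤ N ∧ (∀ i, a i ≤ b i) ∧ (∀ i j, i < j → b i < a j) ∧
      S = ⋃ i, Icc (a i) (b i) := by
  classical
  obtain ⟨cl, hcl⟩ := hlow
  obtain ⟨ch, hch⟩ := hhigh
  have hrN : ∀ x ∉ S, r x ≤ N := fun x hx => by
    have h := hch (max x ch + 1) (by linarith [le_max_right x ch])
    exact h.2 ▸ hmono x hx _ h.1 (by linarith [le_max_left x ch])
  let lev : ℕ → Set ℝ := fun n => {x | x ∉ S ∧ r x = n}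
  have hlt : ∀ {m n x y}, x ∈ lev m → y ∈ lev n → m < n → x < y := by
    intro m n x y hx hy hmn
    by_contra! h
    have := hmono y hy.1 x hx.1 h
    rw [hy.2, hx.2] at this
    omega
  -- Open level sets have no greatest or least element; this is why the endpoints of the gaps belong
  -- to `S`.
  have hup : ∀ {n x}, x ∈ lev n → ∃ y ∈ lev n, x < y := by
    intro n x hx
    obtain ⟨y, hy, hxy⟩ := ((hopen x hx.1).filter_mono nhdsWithin_le_nhds |>.and
      (self_mem_nhdsWithin : Ioi x ∈ 𝓝[>] x)).exists
    exact ⟨y, ⟨hy.1, hy.2.trans hx.2⟩, hxy⟩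
  have hdown : ∀ {n x}, x ∈ lev n → ∃ y ∈ lev n, y < x := by
    intro n x hx
    obtain ⟨y, hy, hxy⟩ := ((hopen x hx.1).filter_mono nhdsWithin_le_nhds |>.and
      (self_mem_nhdsWithin : Iio x ∈ 𝓝[<] x)).exists
    exact ⟨y, ⟨hy.1, hy.2.trans hx.2⟩, hxy⟩
  let T : Finset ℕ := (Finset.range (N + 1)).filter fun n => (lev n).Nonempty
  have hT : ∀ {n}, n ∈ T ↔ (lev n).Nonempty := by
    intro n
    simp only [T, Finset.mem_filter, Finset.mem_range, and_iff_right_iff_imp]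
    rintro ⟨x, hx⟩
    have := hrN x hx.1
    rw [hx.2] at this
    omega
  have h0T : 0 ∈ T := hT.2 ⟨cl - 1, hcl _ (by linarith)⟩
  have hNT : N ∈ T := hT.2 ⟨ch + 1, hch _ (by linarith)⟩
  have hcard : 1 < T.card := Finset.one_lt_card.2 ⟨0, h0T, N, hNT, by omega⟩
  have hcard' : T.card ≤ N + 1 := by
    simpa using Finset.card_filter_le (Finset.range (N + 1)) fun n => (lev n).Nonempty
  obtain ⟨k, hk⟩ : ∃ k, T.card = k + 1 := ⟨T.card - 1, by omega⟩
  -- `e` lists the k + 1 attained ranks; the k spectral intervals lie between consecutive levels.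
  let e := T.orderEmbOfFin hk
  have heT : ∀ i, (lev (e i)).Nonempty := fun i => hT.1 (T.orderEmbOfFin_mem hk i)
  have hesurj : ∀ n ∈ T, ∃ i, e i = n := by
    intro n hn
    have : n ∈ Set.range (T.orderEmbOfFin hk) := by rw [T.range_orderEmbOfFin hk]; exact hn
    exact this
  have he0 : e 0 = 0 := by
    obtain ⟨i, hi⟩ := hesurj 0 h0T
    have := e.monotone (Fin.zero_le i)
    omega
  have heN : e (Fin.last k) = N := by
    obtain ⟨i, hi⟩ := hesurj N hNT
    obtain ⟨x, hx⟩ := heT (Fin.last k)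
    exact le_antisymm (hx.2 ▸ hrN x hx.1) (hi ▸ e.monotone (Fin.le_last i))
  have hee : ∀ i : Fin k, e i.castSucc < e i.succ := fun i => e.strictMono i.castSucc_lt_succ
  have hba : ∀ i : Fin k, BddAbove (lev (e i.castSucc)) := fun i => by
    obtain ⟨y, hy⟩ := heT i.succ
    exact ⟨y, fun x hx => (hlt hx hy (hee i)).le⟩
  have hbb : ∀ i : Fin k, BddBelow (lev (e i.succ)) := fun i => by
    obtain ⟨y, hy⟩ := heT i.castSucc
    exact ⟨y, fun x hx => (hlt hy hx (hee i)).le⟩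
  have hltS : ∀ (i : Fin k) {x}, x ∈ lev (e i.castSucc) → x < sSup (lev (e i.castSucc)) := by
    intro i x hx
    obtain ⟨y, hy, hxy⟩ := hup hx
    exact hxy.trans_le (le_csSup (hba i) hy)
  have hltI : ∀ (i : Fin k) {x}, x ∈ lev (e i.succ) → sInf (lev (e i.succ)) < x := by
    intro i x hx
    obtain ⟨y, hy, hxy⟩ := hdown hx
    exact (csInf_le (hbb i) hy).trans_lt hxy
  refine ⟨k, fun i => sSup (lev (e i.castSucc)), fun i => sInf (lev (e i.succ)), by omega, by omega,
    fun i => ?_, fun i j hij => ?_, ?_⟩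
  · exact csSup_le (heT _) fun x hx => le_csInf (heT _) fun y hy => (hlt hx hy (hee i)).le
  · obtain ⟨y, hy⟩ := heT j.castSucc
    refine lt_trans ?_ (hltS j hy)
    have hle : e i.succ ≤ e j.castSucc := e.monotone (Fin.succ_le_castSucc_iff.2 hij)
    rcases hle.eq_or_lt with h | h
    · exact hltI i (h ▸ hy)
    · obtain ⟨x, hx⟩ := heT i.succ
      exact (hltI i hx).trans (hlt hx hy h)
  · ext z
    simp only [mem_iUnion, mem_Icc]
    constructor
    · intro hz
      -- An index at which having a point below `z` stops. If it never stopped, `z` would lie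
      -- between two points of level `N`, against order-convexity.
      obtain ⟨i, ⟨x, hx, hxz⟩, hi⟩ : ∃ i : Fin k, (∃ x ∈ lev (e i.castSucc), x < z) ∧
          ¬ ∃ x ∈ lev (e i.succ), x < z := by
        by_contra! hcon
        have hall : ∀ i : Fin (k + 1), ∃ x ∈ lev (e i), x < z := by
          intro i
          induction i using Fin.induction with
          | zero =>
            refine ⟨min (cl - 1) (z - 1), ?_, by linarith [min_le_right (cl - 1) (z - 1)]⟩
            rw [he0]
            exact hcl _ (by linarith [min_le_left (cl - 1) (z - 1)])
          | succ i ih => exact hcon i ih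
        obtain ⟨x, hx, hxz⟩ := hall (Fin.last k)
        rw [heN] at hx
        have hy := hch (max z ch + 1) (by linarith [le_max_right z ch])
        exact hconv x hx.1 _ hy.1 (hx.2.trans hy.2.symm) z
          ⟨hxz.le, by linarith [le_max_left z ch]⟩ hz
      refine ⟨i, csSup_le (heT _) fun y hy => ?_, le_csInf (heT _) fun y hy => ?_⟩
      · by_contra! hzy
        exact hconv x hx.1 y hy.1 (hx.2.trans hy.2.symm) z ⟨hxz.le, hzy.le⟩ hz
      · by_contra! hzy
        exact hi ⟨y, hy, hzy⟩
    · rintro ⟨i, h1, h2⟩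
      by_contra hz
      obtain ⟨j, hj⟩ := hesurj (r z) (hT.2 ⟨z, hz, rfl⟩)
      have hzj : z ∈ lev (e j) := ⟨hz, hj.symm⟩
      rcases le_or_gt j i.castSucc with h | h
      · rcases h.eq_or_lt with rfl | h
        · exact absurd (hltS i hzj) (not_lt.2 h1)
        · refine absurd h1 (not_le.2 ?_)
          obtain ⟨x, hx⟩ := heT i.castSucc
          exact (hlt hzj hx (e.strictMono h)).trans (hltS i hx)
      · rcases (Fin.castSucc_lt_iff_succ_le.1 h).eq_or_lt with rfl | h
        · exact absurd (hltI i hzj) (not_lt.2 h2)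
        · refine absurd h2 (not_le.2 ?_)
          obtain ⟨x, hx⟩ := heT i.succ
          exact (hltI i hx).trans (hlt hx hzj (e.strictMono h))

/-! ### Dichotomy projections and the spectral intervals -/

section Dichotomy

variable {N : ℕ} {Φ : ℝ → (L N)ˣ}

/-- `P` is the projection of an exponential dichotomy of the evolution operator
`e^{-γ(t-s)} Φ(t) Φ(s)⁻¹`. -/
def IsDichotomyProjection (Φ : ℝ → (L N)ˣ) (γ : ℝ) (P : L N) : Prop :=
  P * P = P ∧ ∃ K α : ℝ, 1 ≤ K ∧ 0 < α ∧
    (∀ t s : ℝ, s ≤ t →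
      ‖(Φ t : L N) * P * ((Φ s)⁻¹ : (L N)ˣ)‖ ≤ K * Real.exp ((γ - α) * (t - s))) ∧
    (∀ t s : ℝ, t ≤ s →
      ‖(Φ t : L N) * (1 - P) * ((Φ s)⁻¹ : (L N)ˣ)‖ ≤ K * Real.exp ((γ + α) * (t - s)))

/-- The forward estimate weakens as γ increases and the backward one as γ decreases, so each
endpoint supplies one of them. -/
theorem IsDichotomyProjection.of_mem_Icc {γ₁ γ₂ γ : ℝ} {P : L N}
    (h₁ : IsDichotomyProjection Φ γ₁ P) (h₂ : IsDichotomyProjection Φ γ₂ P)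
    (hγ : γ ∈ Icc γ₁ γ₂) : IsDichotomyProjection Φ γ P := by
  obtain ⟨hP, K₁, α₁, hK₁, hα₁, h₁, -⟩ := h₁
  obtain ⟨-, K₂, α₂, hK₂, hα₂, -, h₂⟩ := h₂
  refine ⟨hP, max K₁ K₂, min α₁ α₂, hK₁.trans (le_max_left _ _), lt_min hα₁ hα₂,
    fun t s hts => (h₁ t s hts).trans ?_, fun t s hts => (h₂ t s hts).trans ?_⟩
  · refine mul_le_mul (le_max_left _ _) (Real.exp_le_exp.2 ?_) (Real.exp_pos _).le (by positivity)
    refine mul_le_mul_of_nonneg_right ?_ (by linarith)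
    linarith [hγ.1, min_le_left α₁ α₂]
  · refine mul_le_mul (le_max_right _ _) (Real.exp_le_exp.2 ?_) (Real.exp_pos _).le (by positivity)
    refine mul_le_mul_of_nonpos_right ?_ (by linarith)
    linarith [hγ.2, min_le_right α₁ α₂]

/-- Half of the exponent α absorbs any change of γ up to α / 2. -/
theorem IsDichotomyProjection.eventually {γ : ℝ} {P : L N} (h : IsDichotomyProjection Φ γ P) :
    ∀ᶠ γ' in 𝓝 γ, IsDichotomyProjection Φ γ' P := by
  obtain ⟨hP, K, α, hK, hα, h₁, h₂⟩ := h
  filter_upwards [Icc_mem_nhds (show γ - α / 2 < γ by linarith) (show γ < γ + α / 2 by linarith)]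
    with γ' hγ'
  refine ⟨hP, K, α / 2, hK, by positivity, fun t s hts => (h₁ t s hts).trans ?_,
    fun t s hts => (h₂ t s hts).trans ?_⟩
  · refine mul_le_mul_of_nonneg_left (Real.exp_le_exp.2 ?_) (by linarith)
    exact mul_le_mul_of_nonneg_right (by linarith [hγ'.1]) (by linarith)
  · refine mul_le_mul_of_nonneg_left (Real.exp_le_exp.2 ?_) (by linarith)
    exact mul_le_mul_of_nonpos_right (by linarith [hγ'.2]) (by linarith)

theorem eq_zero_of_norm_le_exp {V : Type*} [NormedAddCommGroup V] {v : V} {C β : ℝ} (hβ : 0 < β)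
    (h : ∀ t : ℝ, 0 ≤ t → ‖v‖ ≤ C * Real.exp (-(β * t))) : v = 0 := by
  have h1 : Tendsto (fun t : ℝ => C * Real.exp (-(β * t))) atTop (𝓝 (C * 0)) :=
    (Real.tendsto_exp_neg_atTop_nhds_zero.comp (tendsto_id.const_mul_atTop hβ)).const_mul C
  rw [mul_zero] at h1
  exact norm_le_zero_iff.1 (ge_of_tendsto h1 ((eventually_ge_atTop 0).mono h))

/-- The identities say range P₁ ⊆ range P₂ and ker P₂ ⊆ ker P₁. Each defect, (1 - P₂)P₁ or P₁(1 -
P₂), is factored through time t or -t, where the two estimates combine to O(e^{-(α₁+α₂)t}); letting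
t → ∞ kills it. -/
theorem IsDichotomyProjection.mul_eq (hΦ : Φ 0 = 1) {γ₁ γ₂ : ℝ} {P₁ P₂ : L N}
    (h₁ : IsDichotomyProjection Φ γ₁ P₁) (h₂ : IsDichotomyProjection Φ γ₂ P₂) (hγ : γ₁ ≤ γ₂) :
    P₂ * P₁ = P₁ ∧ P₁ * P₂ = P₁ := by
  obtain ⟨-, K₁, α₁, hK₁, hα₁, h₁, h₁'⟩ := h₁
  obtain ⟨-, K₂, α₂, hK₂, hα₂, h₂, h₂'⟩ := h₂
  constructor
  · refine (sub_eq_zero.1 (eq_zero_of_norm_le_exp (C := K₂ * K₁) (add_pos hα₁ hα₂)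
      fun t ht => ?_)).symm
    have e1 : P₁ - P₂ * P₁ = ((Φ 0 : L N) * (1 - P₂) * ((Φ t)⁻¹ : (L N)ˣ)) *
        ((Φ t : L N) * P₁ * ((Φ 0)⁻¹ : (L N)ˣ)) := by
      simp only [hΦ, inv_one, Units.val_one, one_mul, mul_one]
      rw [mul_assoc, ← mul_assoc _ (Φ t : L N), Units.inv_mul, one_mul, sub_mul, one_mul]
    rw [e1]
    refine (norm_mul_le _ _).trans ((mul_le_mul (h₂' 0 t ht) (h₁ t 0 ht) (norm_nonneg _)
      (by positivity)).trans ?_)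
    rw [mul_mul_mul_comm, ← Real.exp_add]
    refine mul_le_mul_of_nonneg_left (Real.exp_le_exp.2 ?_) (by positivity)
    nlinarith [mul_nonneg (sub_nonneg.2 hγ) ht]
  · refine (sub_eq_zero.1 (eq_zero_of_norm_le_exp (C := K₁ * K₂) (add_pos hα₁ hα₂)
      fun t ht => ?_)).symm
    have e1 : P₁ - P₁ * P₂ = ((Φ 0 : L N) * P₁ * ((Φ (-t))⁻¹ : (L N)ˣ)) *
        ((Φ (-t) : L N) * (1 - P₂) * ((Φ 0)⁻¹ : (L N)ˣ)) := by
      simp only [hΦ, inv_one, Units.val_one, one_mul, mul_one]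
      rw [mul_assoc, ← mul_assoc _ (Φ (-t) : L N), Units.inv_mul, one_mul, mul_sub, mul_one]
    rw [e1]
    refine (norm_mul_le _ _).trans ((mul_le_mul (h₁ 0 (-t) (by linarith))
      (h₂' (-t) 0 (by linarith)) (norm_nonneg _) (by positivity)).trans ?_)
    rw [mul_mul_mul_comm, ← Real.exp_add]
    refine mul_le_mul_of_nonneg_left (Real.exp_le_exp.2 ?_) (by positivity)
    nlinarith [mul_nonneg (sub_nonneg.2 hγ) ht]

theorem range_le_range_of_mul_eq {P Q : L N} (h : Q * P = P) :
    LinearMap.range (P : E N →ₗ[ℝ] E N) ≤ LinearMap.range (Q : E N →ₗ[ℝ] E N) := by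
  rintro _ ⟨v, rfl⟩
  exact ⟨P v, congrArg (fun T : L N => T v) h⟩

/-- The rank of a linear endomorphism of `ℝ^N`. -/
noncomputable def rank (P : L N) : ℕ := Module.finrank ℝ (LinearMap.range (P : E N →ₗ[ℝ] E N))

theorem IsDichotomyProjection.rank_le (hΦ : Φ 0 = 1) {γ₁ γ₂ : ℝ} {P₁ P₂ : L N}
    (h₁ : IsDichotomyProjection Φ γ₁ P₁) (h₂ : IsDichotomyProjection Φ γ₂ P₂) (hγ : γ₁ ≤ γ₂) :
    rank P₁ ≤ rank P₂ :=
  Submodule.finrank_mono (range_le_range_of_mul_eq (h₁.mul_eq hΦ h₂ hγ).1)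

/-- Equal ranks make the nested ranges equal, so P₁P₂ = P₂, while P₁P₂ = P₁ always. -/
theorem IsDichotomyProjection.eq_of_rank_eq (hΦ : Φ 0 = 1) {γ₁ γ₂ : ℝ} {P₁ P₂ : L N}
    (h₁ : IsDichotomyProjection Φ γ₁ P₁) (h₂ : IsDichotomyProjection Φ γ₂ P₂) (hγ : γ₁ ≤ γ₂)
    (hr : rank P₁ = rank P₂) : P₁ = P₂ := by
  obtain ⟨e1, e2⟩ := h₁.mul_eq hΦ h₂ hγ
  have hrange := Submodule.eq_of_le_of_finrank_eq (range_le_range_of_mul_eq e1) hr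
  rw [← e2]
  ext1 v
  obtain ⟨w, hw⟩ : P₂ v ∈ LinearMap.range (P₁ : E N →ₗ[ℝ] E N) := hrange ▸ ⟨v, rfl⟩
  change P₁ (P₂ v) = P₂ v
  rw [← hw]
  exact congrArg (fun T : L N => T w) h₁.1

/-- The structure of the dichotomy spectrum of an evolution operator with bounded growth. -/
theorem exists_spectral_intervals (hN : 1 ≤ N) (hΦ : Φ 0 = 1) {K α : ℝ} (hK : 1 ≤ K)
    (hb : ∀ t s, ‖(Φ t : L N) * ((Φ s)⁻¹ : (L N)ˣ)‖ ≤ K * Real.exp (α * |t - s|)) :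
    ∃ (k : ℕ) (a b : Fin k → ℝ), 1 ≤ k ∧ k ≤ N ∧ (∀ i, a i ≤ b i) ∧ (∀ i j, i < j → b i < a j) ∧
      {γ | ¬ ∃ P, IsDichotomyProjection Φ γ P} = ⋃ i, Icc (a i) (b i) := by
  classical
  let r : ℝ → ℕ := fun γ =>
    if h : ∃ P, IsDichotomyProjection Φ γ P then rank h.choose else 0
  -- The rank does not depend on the chosen projection, by monotonicity applied both ways at the
  -- same γ. The default 0 on the spectrum is never read.
  have hr : ∀ {γ P}, IsDichotomyProjection Φ γ P → r γ = rank P := by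
    intro γ P hP
    have hex : ∃ P, IsDichotomyProjection Φ γ P := ⟨P, hP⟩
    simp only [r, dif_pos hex]
    exact le_antisymm (hex.choose_spec.rank_le hΦ hP le_rfl)
      (hP.rank_le hΦ hex.choose_spec le_rfl)
  refine exists_eq_iUnion_Icc_of_rank (r := r) hN ?_ ?_ ?_ ⟨-α, fun γ hγ => ?_⟩
    ⟨α, fun γ hγ => ?_⟩
  · intro γ hγ
    obtain ⟨P, hP⟩ := not_not.1 hγ
    filter_upwards [hP.eventually] with γ' hP'
    exact ⟨not_not.2 ⟨P, hP'⟩, (hr hP').trans (hr hP).symm⟩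
  · intro x hx y hy hxy
    obtain ⟨P, hP⟩ := not_not.1 hx
    obtain ⟨Q, hQ⟩ := not_not.1 hy
    rw [hr hP, hr hQ]
    exact hP.rank_le hΦ hQ hxy
  · intro x hx y hy hxy z hz
    obtain ⟨P, hP⟩ := not_not.1 hx
    obtain ⟨Q, hQ⟩ := not_not.1 hy
    rw [hr hP, hr hQ] at hxy
    obtain rfl := hP.eq_of_rank_eq hΦ hQ (hz.1.trans hz.2) hxy
    exact not_not.2 ⟨P, hP.of_mem_Icc hQ hz⟩
  -- For γ < -α the growth bound itself is the backward estimate, with exponent -α - γ; for γ > α it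
  -- is the forward one, with P = 1.
  · have h0 : IsDichotomyProjection Φ γ (0 : L N) := by
      refine ⟨by simp, K, -α - γ, hK, by linarith, fun t s _ => ?_, fun t s hts => ?_⟩
      · simp only [mul_zero, zero_mul, norm_zero]
        positivity
      · have := hb t s
        rw [abs_of_nonpos (by linarith)] at this
        rw [sub_zero, mul_one]
        refine this.trans (le_of_eq ?_)
        ring_nf
    refine ⟨not_not.2 ⟨0, h0⟩, (hr h0).trans ?_⟩
    simp [rank]
  · have h1 : IsDichotomyProjection Φ γ (1 : L N) := by
      refine ⟨by simp, K, γ - α, hK, by linarith, fun t s hts => ?_, fun t s hts => ?_⟩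
      · have := hb t s
        rw [abs_of_nonneg (by linarith)] at this
        rw [mul_one]
        refine this.trans (le_of_eq ?_)
        ring_nf
      · simp only [sub_self, mul_zero, zero_mul, norm_zero]
        positivity
    refine ⟨not_not.2 ⟨1, h1⟩, (hr h1).trans ?_⟩
    have : LinearMap.range ((1 : L N) : E N →ₗ[ℝ] E N) = ⊤ := LinearMap.range_id
    rw [rank, this]
    simp

end Dichotomy


/-! ### From integrals over unit intervals to bounded growth and spectrum -/

section FundamentalSolutions

variable {N : ℕ} {A : ℝ → L N}

theorem isLinearSolution_of_isFundamental {Φ : ℝ → (L N)ˣ} (h : IsFundamental A Φ) :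
    IsLinearSolution A (fun t => (Φ t : L N)) ∧ (Φ 0 : L N) = 1 := by
  obtain ⟨hi, heq⟩ := h
  refine ⟨⟨?_, fun s t => ?_⟩, by simpa using heq 0⟩
  · rw [funext heq]
    exact continuous_const.add (intervalIntegral.continuous_primitive hi 0)
  · change (Φ t : L N) - Φ s = _
    rw [heq s, heq t, add_sub_add_left_eq_sub,
      intervalIntegral.integral_interval_sub_left (hi _ _) (hi _ _)]

theorem isFundamental_of_isLinearSolution (hA : ∀ a b, IntervalIntegrable A volume a b)
    {Φ : ℝ → (L N)ˣ} (h : IsLinearSolution A (fun t => (Φ t : L N))) (h0 : (Φ 0 : L N) = 1) :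
    IsFundamental A Φ := by
  refine ⟨fun a b => (hA a b).mul_continuousOn h.1.continuousOn, fun t => ?_⟩
  have h1 : (Φ t : L N) - Φ 0 = _ := h.2 0 t
  rw [← h1, h0]
  abel

theorem isFundamental_shiftedSolution (hA : ∀ a b, IntervalIntegrable A volume a b)
    {Φ : ℝ → (L N)ˣ} (h : IsLinearSolution A (fun t => (Φ t : L N))) (h0 : Φ 0 = 1) (γ : ℝ) :
    IsFundamental (fun t => A t - γ • (1 : L N)) (shiftedSolution Φ γ) := by
  refine isFundamental_of_isLinearSolution (fun a b => (hA a b).sub intervalIntegrable_const) ?_ ?_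
  · have := h.exp_smul hA (-γ)
    simp only [neg_smul, ← sub_eq_add_neg] at this
    exact this
  · simp [shiftedSolution, h0]

/-- Uniqueness identifies every fundamental solution of the shifted system with e^{-γt}Φ(t), and the
scalar factor moves into the exponents. -/
theorem hasExpDichotomy_sub_smul_iff (hA : ∀ a b, IntervalIntegrable A volume a b)
    {Φ : ℝ → (L N)ˣ} (h : IsLinearSolution A (fun t => (Φ t : L N))) (h0 : Φ 0 = 1) (γ : ℝ) :
    HasExpDichotomy (fun t => A t - γ • (1 : L N)) ↔ ∃ P, IsDichotomyProjection Φ γ P := by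
  have hsh := isFundamental_shiftedSolution hA h h0 γ
  have hscale : ∀ {x u v : ℝ} {K : ℝ}, Real.exp (-γ * u) * x ≤ K * Real.exp v ↔
      x ≤ K * Real.exp (γ * u + v) := by
    intro x u v K
    rw [Real.exp_add, neg_mul, Real.exp_neg, inv_mul_le_iff₀ (Real.exp_pos _)]
    ring_nf
  constructor
  · rintro ⟨Ψ, hΨ, P, hP, K, α, hK, hα, h1, h2⟩
    obtain rfl : Ψ = shiftedSolution Φ γ := by
      funext t
      obtain ⟨hs, hs0⟩ := isLinearSolution_of_isFundamental hΨ
      obtain ⟨hs', hs0'⟩ := isLinearSolution_of_isFundamental hsh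
      exact Units.ext (hs.eq_of_eq_at (fun a b => (hA a b).sub intervalIntegrable_const) hs'
        (hs0.trans hs0'.symm) t)
    refine ⟨P, hP, K, α, hK, hα, fun t s hts => ?_, fun t s hts => ?_⟩
    · have := h1 t s hts
      rw [norm_shiftedSolution_mul_mul_inv, hscale] at this
      convert this using 3
      ring
    · have := h2 t s hts
      rw [norm_shiftedSolution_mul_mul_inv, hscale] at this
      convert this using 3
      ring
  · rintro ⟨P, hP, K, α, hK, hα, h1, h2⟩
    refine ⟨shiftedSolution Φ γ, hsh, P, hP, K, α, hK, hα, fun t s hts => ?_, fun t s hts => ?_⟩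
    · rw [norm_shiftedSolution_mul_mul_inv, hscale]
      convert h1 t s hts using 3
      ring
    · rw [norm_shiftedSolution_mul_mul_inv, hscale]
      convert h2 t s hts using 3
      ring

/-- The interval is covered by ⌈|t - s|⌉ unit intervals; rounding up costs the + 1. -/
theorem abs_integral_le_of_integral_unit_le {a : ℝ → ℝ}
    (ha : ∀ x y, IntervalIntegrable a volume x y) (ha0 : ∀ t, 0 ≤ a t) {C : ℝ}
    (hC : ∀ t, ∫ u in t..t + 1, a u ≤ C) (s t : ℝ) :
    |∫ u in s..t, a u| ≤ C * (|t - s| + 1) := by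
  have hC0 : 0 ≤ C := (intervalIntegral.integral_nonneg (by linarith) fun u _ => ha0 u).trans (hC 0)
  have hn : ∀ (n : ℕ) (s : ℝ), ∫ u in s..s + n, a u ≤ n * C := by
    intro n s
    induction n with
    | zero => simp
    | succ n ih =>
      have := intervalIntegral.integral_add_adjacent_intervals (ha s (s + n)) (ha (s + n) (s + n + 1))
      have h2 := hC (s + n)
      push_cast
      rw [← add_assoc, ← this]
      linarith
  have key : ∀ s t : ℝ, s ≤ t → |∫ u in s..t, a u| ≤ C * (|t - s| + 1) := by
    intro s t hst
    rw [abs_of_nonneg (intervalIntegral.integral_nonneg hst fun u _ => ha0 u),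
      abs_of_nonneg (sub_nonneg.2 hst)]
    have h1 : t ≤ s + (⌈t - s⌉₊ : ℝ) := by linarith [Nat.le_ceil (t - s)]
    have h2 : ∫ u in s..t, a u ≤ ∫ u in s..s + (⌈t - s⌉₊ : ℝ), a u :=
      intervalIntegral.integral_mono_interval le_rfl hst h1 (ae_of_all _ fun u => ha0 u) (ha _ _)
    refine h2.trans ((hn _ s).trans ?_)
    rw [mul_comm]
    exact mul_le_mul_of_nonneg_left (Nat.ceil_lt_add_one (sub_nonneg.2 hst)).le hC0
  rcases le_total s t with h | h
  · exact key s t h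
  · rw [intervalIntegral.integral_symm, abs_neg, abs_sub_comm]
    exact key t s h

/-- Bounded growth and the structure of the dichotomy spectrum, for a linear system whose
coefficient has uniformly bounded integrals over unit intervals. -/
theorem hasBoundedGrowth_and_spectrum (hN : 1 ≤ N) (hA : ∀ a b, IntervalIntegrable A volume a b)
    {C : ℝ} (hC : ∀ t, ∫ u in t..t + 1, ‖A u‖ ≤ C) :
    HasBoundedGrowth A ∧
    ∃ (k : ℕ) (a b : Fin k → ℝ), 1 ≤ k ∧ k ≤ N ∧ (∀ i, a i ≤ b i) ∧ (∀ i j, i < j → b i < a j) ∧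
      dichotomySpectrum A = ⋃ i, Icc (a i) (b i) := by
  obtain ⟨Φ, hΦ, hΦ0, hb⟩ := exists_units_isLinearSolution hA
  have hC0 : 0 ≤ C :=
    (intervalIntegral.integral_nonneg (by linarith) fun u _ => norm_nonneg (A u)).trans (hC 0)
  have hgrowth : ∀ t s, ‖(Φ t : L N) * ((Φ s)⁻¹ : (L N)ˣ)‖ ≤
      Real.exp C * Real.exp (C * |t - s|) := by
    intro t s
    have h1 : ‖(1 : L N)‖ ≤ 1 := ContinuousLinearMap.norm_id_le
    refine (hb t s).trans ((mul_le_of_le_one_left (Real.exp_pos _).le h1).trans ?_)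
    rw [← Real.exp_add]
    refine Real.exp_le_exp.2 ((abs_integral_le_of_integral_unit_le (fun a b => (hA a b).norm)
      (fun t => norm_nonneg _) hC s t).trans (le_of_eq ?_))
    ring
  have hK : 1 ≤ Real.exp C := Real.one_le_exp hC0
  refine ⟨⟨Φ, isFundamental_of_isLinearSolution hA hΦ (by simp [hΦ0]), _, C, hK, hC0, hgrowth⟩, ?_⟩
  have hspec : dichotomySpectrum A = {γ | ¬ ∃ P, IsDichotomyProjection Φ γ P} := by
    ext γ
    exact not_congr (hasExpDichotomy_sub_smul_iff hA hΦ hΦ0 γ)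
  rw [hspec]
  exact exists_spectral_intervals hN hΦ0 hK hgrowth

end FundamentalSolutions

/-! ### The coefficient along an orbit of the base flow -/

section BaseFlow

variable {N : ℕ} {g : ℝ → E N → E N} {x₀ : E N}

theorem isGlobalSolution_sol (h : GloballyDefined g x₀) : IsGlobalSolution g x₀ (sol g x₀) := by
  rw [sol, dif_pos h]
  exact h.choose_spec

theorem IsGlobalSolution.sub_eq {x : ℝ → E N} (h : IsGlobalSolution g x₀ x) (s t : ℝ) :
    x t - x s = ∫ r in s..t, g r (x r) := by
  rw [h.2.2 s, h.2.2 t, add_sub_add_left_eq_sub,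
    intervalIntegral.integral_interval_sub_left (h.2.1 _ _) (h.2.1 _ _)]

theorem IsGlobalSolution.translate {x : ℝ → E N} (h : IsGlobalSolution g x₀ x) (t : ℝ) :
    IsGlobalSolution (translate t g) (x t) fun s => x (s + t) := by
  refine ⟨h.1.comp (continuous_id.add continuous_const), fun a b => ?_, fun s => ?_⟩
  · have := (h.2.1 (a + t) (b + t)).comp_add_right t
    simpa [Carath.translate] using this
  · have h1 := h.sub_eq t (s + t)
    have h2 := intervalIntegral.integral_comp_add_right (a := 0) (b := s)
      (fun r => g r (x r)) t
    simp only [Carath.translate]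
    rw [h2, zero_add, ← h1]
    abel

/-- On [-R, R] both curves stay in one compact set, whose Lipschitz bound is the weight in the
Gronwall-type principle. -/
theorem IsGlobalSolution.eq_of_eq_at (hg : g ∈ LC N (E N)) {y₀ : E N} {x y : ℝ → E N}
    (hx : IsGlobalSolution g x₀ x) (hy : IsGlobalSolution g y₀ y) {t₀ : ℝ} (h : x t₀ = y t₀) :
    x = y := by
  funext t
  refine sub_eq_zero.1 (eq_zero_of_norm_sub_le_integral (u := fun t => x t - y t)
    (hx.1.sub hy.1) (fun R => ?_) (sub_eq_zero.2 h) t)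
  have hcpt : IsCompact (x '' Icc (-R) R ∪ y '' Icc (-R) R) :=
    (isCompact_Icc.image hx.1).union (isCompact_Icc.image hy.1)
  obtain ⟨l, hl, hlip⟩ := hg.2 _ hcpt
  have hli : ∀ a b, IntervalIntegrable (fun t => |l t|) volume a b := fun a b =>
    (intervalIntegrable_of_locallyIntegrable hl a b).norm
  refine ⟨fun t => |l t|, hli, fun t => abs_nonneg _, fun s hs t ht => ?_⟩
  rw [sub_sub_sub_comm, hx.sub_eq, hy.sub_eq, ← intervalIntegral.integral_sub (hx.2.1 _ _)
    (hy.2.1 _ _), ← Real.norm_eq_abs]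
  refine intervalIntegral.norm_integral_le_abs_of_norm_le ?_
    ((hli _ _).mul_continuousOn (hx.1.sub hy.1).norm.continuousOn)
  refine (ae_restrict_iff' measurableSet_uIoc).2 ?_
  filter_upwards [hlip] with r hr hrI
  have hr' : r ∈ Icc (-R) R := uIcc_subset_Icc hs ht (uIoc_subset_uIcc hrI)
  exact (hr _ (Or.inl ⟨r, hr', rfl⟩) _ (Or.inr ⟨r, hr', rfl⟩)).trans
    (mul_le_mul_of_nonneg_right (le_abs_self _) (norm_nonneg _))

/-- `sol` is obtained by choice, so its flow property rests on uniqueness. -/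
theorem sol_translate (hg : g ∈ LC N (E N)) (h : GloballyDefined g x₀) (t : ℝ) :
    sol (translate t g) (sol g x₀ t) = fun s => sol g x₀ (s + t) := by
  have hx := isGlobalSolution_sol h
  have hz := isGlobalSolution_sol ⟨_, hx.translate t⟩
  set z := sol (translate t g) (sol g x₀ t)
  have hz0 : z 0 = sol g x₀ t := by simpa using hz.2.2 0
  -- Translating back lets uniqueness be applied to `g` itself, without a Lipschitz property for its
  -- translate.
  have hy : IsGlobalSolution g (z (-t)) fun s => z (s + -t) := by
    have hgt : translate (-t) (translate t g) = g := by
      funext s y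
      simp [Carath.translate]
    simpa only [hgt] using hz.translate (-t)
  have hxy := hx.eq_of_eq_at hg hy (t₀ := t) (by simp [hz0])
  funext s
  simpa using (congrFun hxy (s + t)).symm

variable {G : ℝ → E N → L N}

theorem intervalIntegrable_comp_of_isC (hG : IsC G) {x : ℝ → E N} (hx : Continuous x) (a b : ℝ) :
    IntervalIntegrable (fun t => G t (x t)) volume a b := by
  obtain ⟨m, hm, hb⟩ := hG.2 _ ((isCompact_uIcc (a := a) (b := b)).image hx)
  have hmeas : Measurable fun t => G t (x t) := hG.1.comp (measurable_id.prodMk hx.measurable)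
  refine (intervalIntegrable_of_locallyIntegrable hm a b).mono_fun
    hmeas.aestronglyMeasurable ?_
  refine (ae_restrict_iff' measurableSet_uIoc).2 ?_
  filter_upwards [hb] with t ht htI
  exact (ht _ ⟨t, uIoc_subset_uIcc htI, rfl⟩).trans (le_abs_self _)

/-- The coefficient matrix along the orbit of `(g, G, x₀)` agrees almost everywhere with `G` along
the solution. -/
theorem coeff_baseFlow_ae_eq (hg : g ∈ LC N (E N)) (hG : IsC G) (h : GloballyDefined g x₀) :
    (fun t => coeff (baseFlow (g, G, x₀) t)) =ᵐ[volume] fun t => G t (sol g x₀ t) := by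
  have hint := intervalIntegrable_comp_of_isC hG (isGlobalSolution_sol h).1
  filter_upwards [LocallyIntegrable.ae_hasDerivAt_integral
    (locallyIntegrable_of_intervalIntegrable hint)] with t ht
  have key : Tendsto (fun h : ℝ => h⁻¹ • ∫ s in (0 : ℝ)..h, (baseFlow (g, G, x₀) t).2.1 s
      (sol (baseFlow (g, G, x₀) t).1 (baseFlow (g, G, x₀) t).2.2 s)) (𝓝[≠] 0)
      (𝓝 (G t (sol g x₀ t))) := by
    have h1 := hasDerivAt_iff_tendsto_slope_zero.1 (ht t)
    simp only [intervalIntegral.integral_same, sub_zero] at h1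
    refine h1.congr fun r => ?_
    simp only [baseFlow]
    rw [sol_translate hg h t]
    have h2 := intervalIntegral.integral_comp_add_right (a := 0) (b := r)
      (fun s => G s (sol g x₀ s)) t
    rw [zero_add, add_comm r t] at h2
    rw [← h2]
    rfl
  have hex : ∃ B : L N, Tendsto (fun h : ℝ => h⁻¹ • ∫ s in (0 : ℝ)..h,
      (baseFlow (g, G, x₀) t).2.1 s (sol (baseFlow (g, G, x₀) t).1
      (baseFlow (g, G, x₀) t).2.2 s)) (𝓝[≠] 0) (𝓝 B) := ⟨_, key⟩
  rw [coeff, dif_pos hex]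
  exact tendsto_nhds_unique hex.choose_spec key

/-- The interval [t, t + 1] lies in [t - 1, t + 1], which is the window [-1, 1] for the translate of
`G` by t; there the uniform bound on m-bounds over B_j applies. -/
theorem exists_integral_norm_comp_le (hG : IsC G) (hGb : HasBoundedMBounds G) {x : ℝ → E N}
    (hx : Continuous x) (hxb : ∃ C : ℝ, ∀ t, ‖x t‖ ≤ C) :
    ∃ C : ℝ, ∀ t, ∫ u in t..t + 1, ‖G u (x u)‖ ≤ C := by
  obtain ⟨c, hc⟩ := hxb
  obtain ⟨j, hj⟩ := exists_nat_ge c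
  obtain ⟨S, -, hS, hSb⟩ := hGb j
  obtain ⟨C, hC⟩ := hSb 1 one_pos
  have hint := intervalIntegrable_comp_of_isC hG hx
  refine ⟨C, fun t => ?_⟩
  obtain ⟨m, hmS, hm, hmb⟩ := hS _ ⟨t, rfl⟩
  refine le_trans ?_ (hC m hmS)
  have h1 : ∫ u in t..t + 1, ‖G u (x u)‖ ≤ ∫ u in (-1 + t)..(1 + t), ‖G u (x u)‖ :=
    intervalIntegral.integral_mono_interval (by linarith) (by linarith) (by linarith)
      (ae_of_all _ fun u => norm_nonneg _) (hint _ _).norm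
  refine h1.trans ?_
  rw [← intervalIntegral.integral_comp_add_right (fun u => ‖G u (x u)‖) t]
  refine intervalIntegral.integral_mono_ae (by norm_num) ?_
    (intervalIntegrable_of_locallyIntegrable hm _ _) ?_
  · simpa using ((hint (-1 + t) (1 + t)).norm).comp_add_right t
  · filter_upwards [hmb] with u hu
    exact hu _ (by simpa using (hc (u + t)).trans hj)

end BaseFlow

end Carath

/-! ### The proposition -/

theorem mainTheorem6 (N : ℕ) (hN : 1 ≤ N)
    (f : ℝ → Carath.E N → Carath.E N) (F : ℝ → Carath.E N → Carath.L N)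
    (hf : f ∈ Carath.LC N (Carath.E N)) (hF : Carath.IsJacobian f F)
    (hfm : Carath.HasEquicontinuousMBounds f)
    (g : ℝ → Carath.E N → Carath.E N) (G : ℝ → Carath.E N → Carath.L N) (x₀ : Carath.E N)
    (hω : (g, G, x₀) ∈ Carath.OmegaStrong f F ∨
      (Carath.HasEquicontinuousMBounds F ∧ (g, G, x₀) ∈ Carath.OmegaSigma f F))
    (hglob : Carath.GloballyDefined g x₀)
    (hG : Carath.HasBoundedMBounds G)
    (hx : ∃ C : ℝ, ∀ t : ℝ, ‖Carath.sol g x₀ t‖ ≤ C) :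
    Carath.HasBoundedGrowth (fun t => Carath.coeff (Carath.baseFlow (g, G, x₀) t)) ∧
    ∃ (k : ℕ) (a b : Fin k → ℝ), 1 ≤ k ∧ k ≤ N ∧ (∀ i, a i ≤ b i) ∧ (∀ i j, i < j → b i < a j) ∧
      Carath.dichotomySpectrum (fun t => Carath.coeff (Carath.baseFlow (g, G, x₀) t)) =
        ⋃ i, Icc (a i) (b i) := by
  obtain ⟨hgLC, hGC⟩ : g ∈ Carath.LC N (Carath.E N) ∧ Carath.IsC G := by
    rcases hω with ⟨p, -, h1, h2⟩ | ⟨-, p, -, h1, h2⟩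
    all_goals
      simp only at h1 h2
      exact ⟨h1 ▸ p.1.2, h2 ▸ p.2.2.1⟩
  have hxc := (Carath.isGlobalSolution_sol hglob).1
  have hae := Carath.coeff_baseFlow_ae_eq hgLC hGC hglob
  obtain ⟨C, hC⟩ := Carath.exists_integral_norm_comp_le hGC hG hxc hx
  -- Integrability and unit integrals pass from G along the solution to `coeff`, since the two agree
  -- a.e.
  refine Carath.hasBoundedGrowth_and_spectrum hN (fun a b => ?_) (C := C) fun t => ?_
  · exact (Carath.intervalIntegrable_comp_of_isC hGC hxc a b).congr_ae (ae_restrict_of_ae hae.symm)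
  · rw [intervalIntegral.integral_congr_ae (g := fun u => ‖G u (Carath.sol g x₀ u)‖)]
    · exact hC t
    · filter_upwards [hae] with u hu _
      rw [hu]
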